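/- Let $(a,b)\times(c,d)$ be a rectangle, $\omega\in\mathbb R$, and impose on all sides either a zero Dirichlet condition, or a zero Neumann condition with $\omega\neq0$. Let $\mathcal T^x$, $\mathcal T^y$ be quasi-uniform families of subdivisions of $[a,b]$, $[c,d]$: for some $\rho>0$, in every member of a family each cell is at least $\rho$ times as long as the longest cell of that member. For a subdivision $T$ with nodes $x_0<\dots<x_n$ and a degree $p\ge1$, let $\mathbf Y_{0:p}$ be the basis consisting of the piecewise linear hat functions ($h_1,\dots,h_{n-1}$ for Dirichlet, $h_0,\dots,h_n$ for Neumann) and, on each cell, the affinely mapped bubble functions $W_k(x)=\frac{(1-x^2)C^{(3/2)}_k(x)}{(k+1)(k+2)}$, $0\le k\le p-2$ (extended by zero), where $C^{(3/2)}_k$ are ultraspherical polynomials. Let $M_T=\langle \mathbf Y_{0:p}^\top,\mathbf Y_{0:p}\rangle$ and $A_T=\langle (\mathbf Y_{0:p}')^\top,\mathbf Y_{0:p}'\rangle+\frac{\omega^2}{2}M_T$ ($L^2$ inner products). The discretised screened Poisson equation on $T_x\times T_y$ is $A_{T_x}UM_{T_y}+M_{T_x}UA_{T_y}=G$. For a generalised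 Sylvester equation $AUC-DUB=F$ and tolerance $\epsilon$, the ADI algorithm takes for $a',b'$ the smallest and largest generalised eigenvalues of $(A,D)$, i.e. the smallest and largest $\mu$ with $A-\mu D$ singular, and for $c',d'$ those of $(B,C)$. It performs $$J=\left\lceil \frac{\log(16\gamma)\,\log(4/\epsilon)}{\pi^2}\right\rceil ,\qquad \gamma=\frac{|c'-a'|\,|d'-b'|}{|c'-b'|\,|d'-a'|},$$ iterations; it requires $[a',b']\cap[c',d']=\emptyset$. Apply it to the discretised equation with $(A,B,C,D)=(M_{T_x},-M_{T_y},A_{T_y},A_{T_x})$ or with $(A,B,C,D)=(A_{T_x},-A_{T_y},M_{T_y},M_{T_x})$. Then $J=O(\log N\,\log\epsilon^{-1})$, where $N$ is the larger of the numbers of basis functions in the two coordinate directions. Precisely: for every $\epsilon_0<1$ there is $K>0$, depending only on the rectangle, the boundary condition, $\omega$, the two families and $\epsilon_0$, such that for all $T_x\in\mathcal T^x$, $T_y\in\mathcal T^y$, all $p\ge1$ for which both bases are non-empty and $N\ge2$, and all $0<\epsilon\le\epsilon_0$, the extreme eigenvalues exist and give disjoint intervals, $J$ is the same for the two choices of $(A,B,C,D)$,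 and $$J\le K\,\log N\,\log\epsilon^{-1}.$$ -/

import Mathlib

namespace ScreenedPoisson

/-- Ultraspherical (Gegenbauer) polynomials `C_k^{(lam)}`, by the three-term recurrence
`(k+2) C_{k+2} = 2 (k+1+lam) x C_{k+1} - (k+2 lam) C_k`. They are orthogonal on `[-1,1]` with
respect to `(1-x^2)^(lam-1/2)` and have leading coefficient `2^k (lam)_k / k!`. -/
noncomputable def ultraspherical (lam : ℝ) : ℕ → Polynomial ℝ
  | 0 => 1
  | 1 => Polynomial.C (2 * lam) * Polynomial.X
  | (k + 2) => Polynomial.C (1 / ((k : ℝ) + 2)) *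
      (Polynomial.C (2 * ((k : ℝ) + 1 + lam)) * Polynomial.X * ultraspherical lam (k + 1)
        - Polynomial.C ((k : ℝ) + 2 * lam) * ultraspherical lam k)

/-- The integrated Legendre function
`W_k(x) = (1 - x^2) C_k^{(3/2)}(x) / ((k+1)(k+2))`, of degree `k + 2`. -/
noncomputable def W (k : ℕ) : Polynomial ℝ :=
  Polynomial.C (1 / (((k : ℝ) + 1) * ((k : ℝ) + 2))) *
    ((1 - Polynomial.X ^ 2) * ultraspherical (3 / 2) k)

/-- A subdivision `a = x_0 < x_1 < ... < x_n = b` of `[a,b]` into `n` cells (`n ≥ 1` as soon as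
`a < b`). Only the values `node 0, ..., node n` are meaningful. -/
structure Subdivision (a b : ℝ) where
  n : ℕ
  node : ℕ → ℝ
  node_zero : node 0 = a
  node_last : node n = b
  node_lt : ∀ i < n, node i < node (i + 1)

namespace Subdivision

variable {a b : ℝ} (T : Subdivision a b)

/-- Length of the cell `[x_i, x_{i+1}]`, for `i < n`. -/
def cellLength (i : ℕ) : ℝ := T.node (i + 1) - T.node i

open Classical in
/-- The piecewise linear hat function `h_j`, for `0 ≤ j ≤ n`. -/
noncomputable def hat (j : ℕ) (t : ℝ) : ℝ :=
  if 1 ≤ j ∧ t ∈ Set.Icc (T.node (j - 1)) (T.node j) then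
    (t - T.node (j - 1)) / (T.node j - T.node (j - 1))
  else if j < T.n ∧ t ∈ Set.Icc (T.node j) (T.node (j + 1)) then
    (T.node (j + 1) - t) / (T.node (j + 1) - T.node j)
  else 0

open Classical in
/-- The bubble function: `W_k` mapped affinely to the cell `[x_j, x_{j+1}]` (`j < n`),
and `0` off that cell. -/
noncomputable def bubble (k j : ℕ) (t : ℝ) : ℝ :=
  if t ∈ Set.Icc (T.node j) (T.node (j + 1)) then
    (W k).eval ((2 * t - T.node j - T.node (j + 1)) / (T.node (j + 1) - T.node j))
  else 0

end Subdivision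

/-- A family of subdivisions of `[a,b]` is quasi-uniform if, for some `ρ > 0` common to the whole
family, in each member every cell is at least `ρ` times as long as every other cell. -/
def QuasiUniform {a b : ℝ} (𝒯 : Set (Subdivision a b)) : Prop :=
  ∃ ρ : ℝ, 0 < ρ ∧ ∀ T ∈ 𝒯, ∀ i < T.n, ∀ j < T.n, ρ * T.cellLength j ≤ T.cellLength i

/-- The zero boundary condition imposed. -/
inductive BoundaryCondition
  | dirichlet
  | neumann

/-- Number of hat functions in the basis: `h_1, ..., h_{n-1}` for Dirichlet and
`h_0, ..., h_n` for Neumann. -/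
def numHats : BoundaryCondition → ℕ → ℕ
  | .dirichlet, n => n - 1
  | .neumann, n => n + 1

/-- Index of the first hat function in the basis. -/
def firstHat : BoundaryCondition → ℕ
  | .dirichlet => 1
  | .neumann => 0

/-- Indices of the basis `Y_{0:p} = [hats | W_0 | ... | W_{p-2}]`; here `Y = Q` for Dirichlet and
`Y = C` for Neumann. -/
abbrev Dof (bc : BoundaryCondition) (n p : ℕ) : Type :=
  Fin (numHats bc n) ⊕ (Fin (p - 1) × Fin n)

variable {a b : ℝ}

/-- The number of degrees of freedom: `p n - 1` for Dirichlet and `p n + 1` for Neumann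
(when `p, n ≥ 1`). -/
def numDof (bc : BoundaryCondition) (T : Subdivision a b) (p : ℕ) : ℕ :=
  Fintype.card (Dof bc T.n p)

/-- The basis functions `Y_{0:p}`. -/
noncomputable def basisFun (bc : BoundaryCondition) (T : Subdivision a b) (p : ℕ) :
    Dof bc T.n p → ℝ → ℝ
  | .inl j => T.hat (firstHat bc + j)
  | .inr (k, j) => T.bubble k j

/-- The mass matrix `M_{Y,p}`. -/
noncomputable def massMatrix (bc : BoundaryCondition) (T : Subdivision a b) (p : ℕ) :
    Matrix (Dof bc T.n p) (Dof bc T.n p) ℝ :=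
  Matrix.of fun i j => ∫ t in a..b, basisFun bc T p i t * basisFun bc T p j t

/-- The stiffness matrix (weak Laplacian) `(-Δ)_{Y,p}`. The basis functions are continuous piecewise
polynomials on `[a,b]`, so `deriv` is their weak derivative off the finitely many nodes. -/
noncomputable def stiffnessMatrix (bc : BoundaryCondition) (T : Subdivision a b) (p : ℕ) :
    Matrix (Dof bc T.n p) (Dof bc T.n p) ℝ :=
  Matrix.of fun i j =>
    ∫ t in a..b, deriv (basisFun bc T p i) t * deriv (basisFun bc T p j) t

/-- `A_{Y,p} = (-Δ)_{Y,p} + (ω²/2) M_{Y,p}`. -/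
noncomputable def energyMatrix (bc : BoundaryCondition) (ω : ℝ) (T : Subdivision a b) (p : ℕ) :
    Matrix (Dof bc T.n p) (Dof bc T.n p) ℝ :=
  stiffnessMatrix bc T p + (ω ^ 2 / 2) • massMatrix bc T p

/-- The (real) generalised eigenvalues `σ(A, B) = {μ : A - μ B is not invertible}`. For `A`
symmetric and `B` symmetric positive definite all generalised eigenvalues are real. -/
def genSpectrum {ι : Type*} [Fintype ι] [DecidableEq ι] (A B : Matrix ι ι ℝ) : Set ℝ :=
  {μ | ¬ IsUnit (A - μ • B)}

/-- The quantity `γ` of the intervals `[a,b]` and `[c,d]`. -/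
noncomputable def adiGamma (a b c d : ℝ) : ℝ :=
  (|c - a| * |d - b|) / (|c - b| * |d - a|)

/-- `J` is the number of iterations that the generalised ADI algorithm performs for the equation
`A U C - D U B = F` with tolerance `ε`: the extreme generalised eigenvalues give disjoint intervals
`[a,b] ⊇ σ(A,D)` and `[c,d] ⊇ σ(B,C)`, and `J = ⌈log(16γ) log(4/ε) / π²⌉`. -/
def IsADIIterationCount {ι κ : Type*} [Fintype ι] [DecidableEq ι] [Fintype κ] [DecidableEq κ]
    (A : Matrix ι ι ℝ) (B C : Matrix κ κ ℝ) (D : Matrix ι ι ℝ) (ε : ℝ) (J : ℕ) : Prop :=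
  ∃ a b c d : ℝ,
    IsLeast (genSpectrum A D) a ∧ IsGreatest (genSpectrum A D) b ∧
    IsLeast (genSpectrum B C) c ∧ IsGreatest (genSpectrum B C) d ∧
    Disjoint (Set.Icc a b) (Set.Icc c d) ∧
    J = ⌈Real.log (16 * adiGamma a b c d) * Real.log (4 / ε) / Real.pi ^ 2⌉₊

end ScreenedPoisson

/-! Since `J` depends on the spectra only through `log (16γ)`, it suffices to bound `γ` by a fixed
power of `N`; the exponent only affects `K`, so crude inequalities will do.

Both mass matrices `M` and energy matrices `E` are positive definite, so the pencil in `x` has its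
spectrum in some `[α, β]` with `α > 0`, while the negated pencil in `y` has a negative spectrum.
This gives existence and disjointness, and monotonicity gives `γ ≤ β/α`: only positivity is needed
from the `y` direction. Exchanging the roles of `M` and `E` inverts all eigenvalues, and `γ` is a
cross-ratio, hence unchanged; so `J` is the same for both choices.

It remains to compare `M` and `E` (`QuasiUniform.exists_spectral_bounds`). `M ≤ C E` is a Poincaré
inequality for Dirichlet and is immediate from the `ω²` term for Neumann. `E ≤ C N⁶ M` is an inverse
inequality: on each cell, Markov's inequality gives `‖q'‖² ≤ 512 p⁶ h⁻² ‖q‖²`, quasi-uniformity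
gives `h ≥ ρ(b - a)/n`, and `pn ≤ 2N`. Thus `γ ≤ C² N⁶`. Finally `log N ≥ log 2` and `log ε⁻¹ ≥ log
ε₀⁻¹` absorb the constants and the rounding (`exists_ceil_le_log_mul_log`). -/

namespace ScreenedPoisson

/-! ### Markov, Nikolskii and inverse inequalities for polynomials on an interval. -/

section PolynomialInequalities

open Polynomial

/-- Markov's inequality at the right end point of `[-1,1]`. -/
theorem abs_eval_one_derivative_le {q : ℝ[X]} {d : ℕ} (hq : q.natDegree ≤ d) {S : ℝ}
    (hS : 0 < S) (hqS : ∀ x ∈ Set.Icc (-1 : ℝ) 1, |q.eval x| ≤ S) :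
    |q.derivative.eval 1| ≤ (d : ℝ) ^ 2 * S := by
  -- The Chebyshev polynomial has the largest derivative at `1` among polynomials of degree at most
  -- `d` bounded by `1`, namely `d²`. The sign `e` yields both halves of the absolute value.
  have key : ∀ e : ℝ, |e| = 1 → e * q.derivative.eval 1 ≤ (d : ℝ) ^ 2 * S := by
    intro e he
    have h := Chebyshev.eval_iterate_derivative_le_of_forall_abs_le_one (n := d)
      (P := C (e / S) * q) (k := 1) (x := 1) le_rfl
      ((degree_C_mul_le _ _).trans (natDegree_le_iff_degree_le.mp hq)) (by
        intro x hx
        rw [eval_mul, eval_C, abs_mul, abs_div, he, abs_of_pos hS, div_mul_eq_mul_div, one_mul,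
          div_le_one hS]
        exact hqS x hx)
    have hT : (derivative (Chebyshev.T ℝ (d : ℤ))).eval 1 = (d : ℝ) ^ 2 := by
      rw [Chebyshev.derivative_T_eval_one]; norm_cast
    simp only [Function.iterate_one, hT, derivative_C_mul, eval_mul, eval_C] at h
    rw [div_mul_eq_mul_div, div_le_iff₀ hS] at h
    exact h
  rw [abs_le']
  have h1 := key 1 (by simp)
  have h2 := key (-1) (by simp)
  exact ⟨by linarith, by linarith⟩
where
  degree_C_mul_le (c : ℝ) (q : ℝ[X]) : (C c * q).degree ≤ q.degree := by
    by_cases hc : c = 0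
    · simp [hc]
    · rw [degree_C_mul hc]

/-- Markov's inequality at an end point `t` of an interval with other end point `s`. -/
theorem abs_eval_derivative_le_of_uIcc {q : ℝ[X]} {d : ℕ} (hq : q.natDegree ≤ d) {S : ℝ}
    (hS : 0 < S) {s t : ℝ} (hst : s ≠ t) (hqS : ∀ x ∈ Set.uIcc s t, |q.eval x| ≤ S) :
    |q.derivative.eval t| ≤ 2 * (d : ℝ) ^ 2 * S / |t - s| := by
  -- The affine substitution sends `-1` to `s` and `1` to `t`; its slope produces the factor `2 / |t
  -- - s|`.
  have hdeg : (q.comp (C ((t - s) / 2) * X + C ((s + t) / 2))).natDegree ≤ d := by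
    refine natDegree_comp_le.trans ?_
    refine (Nat.mul_le_mul_left _ (natDegree_linear_le (a := (t - s) / 2)
      (b := (s + t) / 2))).trans ?_
    simpa using hq
  have h := abs_eval_one_derivative_le hdeg hS (by
    intro x hx
    rw [eval_comp]
    apply hqS
    simp only [eval_add, eval_mul, eval_C, eval_X]
    rw [Set.mem_uIcc]
    rcases le_total s t with h | h
    · left; constructor <;> nlinarith [hx.1, hx.2]
    · right; constructor <;> nlinarith [hx.1, hx.2])
  rw [derivative_comp] at h
  simp only [derivative_add, derivative_mul, derivative_C, zero_mul, derivative_X, mul_one,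
    zero_add, add_zero, eval_mul, eval_C, eval_comp, eval_add, eval_X] at h
  rw [show (t - s) / 2 + (s + t) / 2 = t by ring, abs_mul, abs_div, abs_two] at h
  have hpos : 0 < |t - s| := abs_pos.mpr (sub_ne_zero.mpr hst.symm)
  rw [le_div_iff₀ hpos]
  linarith

/-- A form of Markov's inequality on `[s,t]`, with a constant that is not sharp. -/
theorem abs_eval_derivative_le {q : ℝ[X]} {d : ℕ} (hq : q.natDegree ≤ d) {S : ℝ}
    (hS : 0 < S) {s t : ℝ} (hst : s < t) (hqS : ∀ x ∈ Set.Icc s t, |q.eval x| ≤ S)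
    {x : ℝ} (hx : x ∈ Set.Icc s t) :
    |q.derivative.eval x| ≤ 4 * (d : ℝ) ^ 2 * S / (t - s) := by
  -- An interior `x` is treated as an end point of the interval joining it to the farther end `y`,
  -- which has at least half the length; hence `4` in place of `2`.
  have main : ∀ y ∈ Set.Icc s t, t - s ≤ 2 * |x - y| →
      |q.derivative.eval x| ≤ 4 * (d : ℝ) ^ 2 * S / (t - s) := by
    intro y hy hxy
    have hts : 0 < t - s := sub_pos.mpr hst
    have hpos : 0 < |x - y| := by linarith
    have hne : y ≠ x := by
      rintro rfl
      simp at hpos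
    refine (abs_eval_derivative_le_of_uIcc hq hS hne
      (fun z hz => hqS z (Set.uIcc_subset_Icc hy hx hz))).trans ?_
    rw [div_le_div_iff₀ hpos hts]
    have h0 : 0 ≤ (d : ℝ) ^ 2 * S := by positivity
    nlinarith
  rcases le_total (s + t) (2 * x) with h | h
  · exact main s ⟨le_rfl, hst.le⟩ (by have := le_abs_self (x - s); linarith)
  · exact main t ⟨hst.le, le_rfl⟩ (by have := neg_abs_le (x - t); linarith)

/-- Nikolskii's inequality: the maximum of a polynomial is bounded by its `L²` norm. -/
theorem exists_sup_sq_le_integral {q : ℝ[X]} {d : ℕ} (hd : 1 ≤ d) (hq : q.natDegree ≤ d)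
    {s t : ℝ} (hst : s < t) :
    ∃ S : ℝ, 0 ≤ S ∧ (∀ x ∈ Set.Icc s t, |q.eval x| ≤ S) ∧
      S ^ 2 * (t - s) ≤ 32 * (d : ℝ) ^ 2 * ∫ x in s..t, q.eval x ^ 2 := by
  have hts : 0 < t - s := sub_pos.mpr hst
  have hd1 : (1 : ℝ) ≤ d := by exact_mod_cast hd
  have hd2 : (1 : ℝ) ≤ (d : ℝ) ^ 2 := one_le_pow₀ hd1
  have hd0 : (d : ℝ) ≠ 0 := by positivity
  obtain ⟨x₀, hx₀, hmax⟩ := isCompact_Icc.exists_isMaxOn (Set.nonempty_Icc.mpr hst.le)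
    (q.continuous.abs.continuousOn (s := Set.Icc s t))
  have hmax' : ∀ x ∈ Set.Icc s t, |q.eval x| ≤ |q.eval x₀| := fun x hx => hmax hx
  set S := |q.eval x₀| with hSdef
  have hS0 : 0 ≤ S := abs_nonneg _
  refine ⟨S, hS0, hmax', ?_⟩
  have hint0 : ∀ u v : ℝ, u ≤ v → 0 ≤ ∫ x in u..v, q.eval x ^ 2 := fun u v huv =>
    intervalIntegral.integral_nonneg huv (fun x _ => sq_nonneg _)
  rcases hS0.eq_or_lt with h0 | hS
  · rw [← h0]
    have := hint0 s t hst.le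
    rw [zero_pow two_ne_zero, zero_mul]
    positivity
  -- With slope at most `4d²S/(t - s)`, `|q|` drops by at most `S/2` within distance `δ` of its
  -- maximum point. As `δ ≤ (t - s)/2`, an interval of length `δ` fits on one side of that point,
  -- and `32 = 8 · 2²`.
  set δ := (t - s) / (8 * (d : ℝ) ^ 2) with hδ
  have hδ0 : 0 < δ := by positivity
  have hδle : δ ≤ (t - s) / 2 := by
    rw [hδ]
    gcongr
    linarith
  have hlow : ∀ x ∈ Set.Icc s t, |x - x₀| ≤ δ → (S / 2) ^ 2 ≤ q.eval x ^ 2 := by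
    intro x hx hxx
    have hlip : |q.eval x - q.eval x₀| ≤ 4 * (d : ℝ) ^ 2 * S / (t - s) * |x - x₀| := by
      have := Convex.norm_image_sub_le_of_norm_deriv_le (f := fun x => q.eval x)
        (C := 4 * (d : ℝ) ^ 2 * S / (t - s)) (s := Set.Icc s t)
        (fun x _ => q.differentiable.differentiableAt)
        (fun x hx => by
          rw [Polynomial.deriv, Real.norm_eq_abs]
          exact abs_eval_derivative_le hq hS hst hmax' hx) (convex_Icc s t) hx₀ hx
      simpa using this
    have h1 : |q.eval x - q.eval x₀| ≤ S / 2 := by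
      refine hlip.trans ((mul_le_mul_of_nonneg_left hxx (by positivity)).trans_eq ?_)
      rw [hδ]
      field_simp
      norm_num
    have h2 : S / 2 ≤ |q.eval x| := by
      have := abs_sub_abs_le_abs_sub (q.eval x₀) (q.eval x)
      rw [abs_sub_comm] at this
      linarith
    rw [← sq_abs (q.eval x)]
    gcongr
  have hsub : ∃ u v : ℝ, s ≤ u ∧ v ≤ t ∧ v - u = δ ∧ ∀ x ∈ Set.Icc u v, |x - x₀| ≤ δ := by
    rcases le_total (s + t) (2 * x₀) with h | h
    · refine ⟨x₀ - δ, x₀, by linarith, hx₀.2, by ring, fun x hx => ?_⟩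
      rw [abs_le]
      exact ⟨by linarith [hx.1], by linarith [hx.2]⟩
    · refine ⟨x₀, x₀ + δ, hx₀.1, by linarith, by ring, fun x hx => ?_⟩
      rw [abs_le]
      exact ⟨by linarith [hx.1], by linarith [hx.2]⟩
  obtain ⟨u, v, hsu, hvt, huv, hclose⟩ := hsub
  have huv' : u ≤ v := by linarith
  have hcont : Continuous fun x => q.eval x ^ 2 := q.continuous.pow 2
  have h3 : δ * (S / 2) ^ 2 ≤ ∫ x in u..v, q.eval x ^ 2 := by
    have := intervalIntegral.integral_mono_on (μ := MeasureTheory.volume) huv' (f := fun _ => (S / 2) ^ 2)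
      (g := fun x => q.eval x ^ 2) intervalIntegrable_const (hcont.intervalIntegrable u v)
      (fun x hx => hlow x ⟨hsu.trans hx.1, hx.2.trans hvt⟩ (hclose x hx))
    rwa [intervalIntegral.integral_const, huv, smul_eq_mul] at this
  have h4 : ∫ x in u..v, q.eval x ^ 2 ≤ ∫ x in s..t, q.eval x ^ 2 :=
    intervalIntegral.integral_mono_interval hsu huv' hvt
      (Filter.Eventually.of_forall fun x => sq_nonneg _) (hcont.intervalIntegrable s t)
  calc S ^ 2 * (t - s) = 32 * (d : ℝ) ^ 2 * (δ * (S / 2) ^ 2) := by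
        rw [hδ]; field_simp; norm_num
    _ ≤ _ := mul_le_mul_of_nonneg_left (h3.trans h4) (by positivity)

/-- A polynomial whose `L²` norm on an interval vanishes is zero. -/
theorem eq_zero_of_integral_sq_eq_zero {q : ℝ[X]} {s t : ℝ} (hst : s < t)
    (h : ∫ x in s..t, q.eval x ^ 2 = 0) : q = 0 := by
  obtain ⟨S, hS0, hS, hle⟩ := exists_sup_sq_le_integral (d := q.natDegree + 1) (q := q)
    (by omega) (by omega) hst
  rw [h, mul_zero] at hle
  have hS' : S = 0 := by
    have : 0 < t - s := sub_pos.mpr hst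
    have : S ^ 2 ≤ 0 := by
      by_contra! hc
      have := mul_pos hc this
      linarith
    nlinarith
  apply q.eq_zero_of_infinite_isRoot
  refine Set.Infinite.mono (s := Set.Icc s t) (fun x hx => ?_) (Set.Icc_infinite hst)
  have := hS x hx
  rw [hS'] at this
  exact abs_nonpos_iff.mp this

/-- An inverse inequality for polynomials on an interval. -/
theorem integral_derivative_sq_le {q : ℝ[X]} {d : ℕ} (hd : 1 ≤ d) (hq : q.natDegree ≤ d)
    {s t : ℝ} (hst : s < t) :
    ∫ x in s..t, q.derivative.eval x ^ 2 ≤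
      512 * (d : ℝ) ^ 6 / (t - s) ^ 2 * ∫ x in s..t, q.eval x ^ 2 := by
  have hts : 0 < t - s := sub_pos.mpr hst
  obtain ⟨S, hS0, hS, hle⟩ := exists_sup_sq_le_integral hd hq hst
  rcases hS0.eq_or_lt with h0 | hSpos
  · have : q = 0 := by
      apply q.eq_zero_of_infinite_isRoot
      refine Set.Infinite.mono (s := Set.Icc s t) (fun x hx => ?_) (Set.Icc_infinite hst)
      have := hS x hx
      rw [← h0] at this
      exact abs_nonpos_iff.mp this
    simp [this]
  have hcont : Continuous fun x => q.derivative.eval x ^ 2 := q.derivative.continuous.pow 2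
  have h1 : ∫ x in s..t, q.derivative.eval x ^ 2 ≤
      (t - s) * (4 * (d : ℝ) ^ 2 * S / (t - s)) ^ 2 := by
    have := intervalIntegral.integral_mono_on (μ := MeasureTheory.volume) hst.le (f := fun x => q.derivative.eval x ^ 2)
      (g := fun _ => (4 * (d : ℝ) ^ 2 * S / (t - s)) ^ 2) (hcont.intervalIntegrable s t)
      (continuous_const.intervalIntegrable s t)
      (fun x hx => by
        rw [← sq_abs (q.derivative.eval x)]
        gcongr
        exact abs_eval_derivative_le hq hSpos hst hS hx)
    rwa [intervalIntegral.integral_const, smul_eq_mul] at this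
  refine h1.trans ?_
  -- The constant is `512 = 4² · 32`: Markov squared, then Nikolskii.
  calc (t - s) * (4 * (d : ℝ) ^ 2 * S / (t - s)) ^ 2
      = 16 * (d : ℝ) ^ 4 / (t - s) ^ 2 * (S ^ 2 * (t - s)) := by field_simp; norm_num
    _ ≤ 16 * (d : ℝ) ^ 4 / (t - s) ^ 2 * (32 * (d : ℝ) ^ 2 * ∫ x in s..t, q.eval x ^ 2) := by
        gcongr
    _ = _ := by ring

end PolynomialInequalities

/-! ### Symmetric definite pencils, their extreme eigenvalues and `γ`. -/

section GeneralizedEigenvalues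

open Matrix

variable {ι : Type*} [Fintype ι] [DecidableEq ι]

theorem exists_conjTranspose_mul_self_eq {D : Matrix ι ι ℝ} (hD : D.PosDef) :
    ∃ B : Matrix ι ι ℝ, IsUnit B ∧ D = Bᴴ * B := by
  open scoped MatrixOrder Matrix.Norms.L2Operator in
  obtain ⟨B, hB⟩ := CStarAlgebra.nonneg_iff_eq_star_mul_self.mp
    (Matrix.nonneg_iff_posSemidef.mpr hD.posSemidef)
  refine ⟨B, ?_, hB⟩
  have h := hD.isUnit
  rw [hB] at h
  rw [Matrix.isUnit_iff_isUnit_det] at h ⊢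
  rw [Matrix.det_mul] at h
  exact isUnit_of_mul_isUnit_right h

/-- The generalised spectrum of a symmetric matrix with respect to a positive definite one is the
spectrum of a symmetric matrix. -/
theorem exists_isHermitian_genSpectrum_eq {A D : Matrix ι ι ℝ} (hA : A.IsHermitian)
    (hD : D.PosDef) :
    ∃ H : Matrix ι ι ℝ, H.IsHermitian ∧ genSpectrum A D = spectrum ℝ H := by
  obtain ⟨B, hB, hDB⟩ := exists_conjTranspose_mul_self_eq hD
  have hdet : IsUnit B.det := (Matrix.isUnit_iff_isUnit_det B).mp hB
  have hBH : IsUnit Bᴴ := by simpa using hB.star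
  have hdetH : IsUnit Bᴴ.det := (Matrix.isUnit_iff_isUnit_det _).mp hBH
  refine ⟨(B⁻¹)ᴴ * A * B⁻¹, Matrix.isHermitian_conjTranspose_mul_mul _ hA, ?_⟩
  ext μ
  -- The congruence by the invertible `B` turns the pencil into an ordinary resolvent.
  have key : A - μ • D = -(Bᴴ * (algebraMap ℝ (Matrix ι ι ℝ) μ - (B⁻¹)ᴴ * A * B⁻¹) * B) := by
    rw [hDB, mul_sub, sub_mul, neg_sub, Algebra.algebraMap_eq_smul_one, mul_smul_comm, mul_one,
      smul_mul_assoc]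
    congr 1
    rw [Matrix.conjTranspose_nonsing_inv, Matrix.mul_assoc, Matrix.mul_assoc, Matrix.mul_assoc,
      Matrix.nonsing_inv_mul _ hdet, Matrix.mul_one, ← Matrix.mul_assoc,
      Matrix.mul_nonsing_inv _ hdetH, Matrix.one_mul]
  rw [genSpectrum, Set.mem_ofPred_eq, spectrum.mem_iff, not_iff_not, key, IsUnit.neg_iff]
  obtain ⟨u, hu⟩ := hB
  obtain ⟨w, hw⟩ := hBH
  generalize algebraMap ℝ (Matrix ι ι ℝ) μ - (B⁻¹)ᴴ * A * B⁻¹ = Z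
  rw [← hw]
  clear hw
  rw [← hu, Units.isUnit_mul_units, Units.isUnit_units_mul]

theorem genSpectrum_finite {A D : Matrix ι ι ℝ} (hA : A.IsHermitian) (hD : D.PosDef) :
    (genSpectrum A D).Finite := by
  obtain ⟨H, hH, h⟩ := exists_isHermitian_genSpectrum_eq hA hD
  rw [h, hH.spectrum_real_eq_range_eigenvalues]
  exact Set.finite_range _

theorem genSpectrum_nonempty [Nonempty ι] {A D : Matrix ι ι ℝ} (hA : A.IsHermitian)
    (hD : D.PosDef) : (genSpectrum A D).Nonempty := by
  obtain ⟨H, hH, h⟩ := exists_isHermitian_genSpectrum_eq hA hD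
  rw [h, hH.spectrum_real_eq_range_eigenvalues]
  exact Set.range_nonempty _

theorem exists_isLeast_isGreatest_genSpectrum [Nonempty ι] {A D : Matrix ι ι ℝ}
    (hA : A.IsHermitian) (hD : D.PosDef) :
    ∃ a b : ℝ, IsLeast (genSpectrum A D) a ∧ IsGreatest (genSpectrum A D) b := by
  have hfin := genSpectrum_finite hA hD
  have hne := genSpectrum_nonempty hA hD
  obtain ⟨a, ha, ha'⟩ := Set.exists_min_image _ id hfin hne
  obtain ⟨b, hb, hb'⟩ := Set.exists_max_image _ id hfin hne
  exact ⟨a, b, ⟨ha, fun x hx => ha' x hx⟩, ⟨hb, fun x hx => hb' x hx⟩⟩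

/-- A kernel vector of `A - μ D` has Rayleigh quotient `μ`, so bounds on quadratic forms become
bounds on eigenvalues. -/
theorem exists_dotProduct_eq_of_mem_genSpectrum {A D : Matrix ι ι ℝ} {μ : ℝ}
    (hμ : μ ∈ genSpectrum A D) :
    ∃ v : ι → ℝ, v ≠ 0 ∧ v ⬝ᵥ A *ᵥ v = μ * (v ⬝ᵥ D *ᵥ v) := by
  rw [genSpectrum, Set.mem_ofPred_eq, Matrix.isUnit_iff_isUnit_det, isUnit_iff_ne_zero,
    not_not] at hμ
  obtain ⟨v, hv, hv'⟩ := Matrix.exists_mulVec_eq_zero_iff.mpr hμ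
  refine ⟨v, hv, ?_⟩
  rw [Matrix.sub_mulVec, sub_eq_zero, Matrix.smul_mulVec] at hv'
  rw [hv', dotProduct_smul, smul_eq_mul]

theorem genSpectrum_le {A D : Matrix ι ι ℝ} (hD : D.PosDef) {β : ℝ}
    (h : ∀ v, v ⬝ᵥ A *ᵥ v ≤ β * (v ⬝ᵥ D *ᵥ v)) {μ : ℝ} (hμ : μ ∈ genSpectrum A D) : μ ≤ β := by
  obtain ⟨v, hv, hvμ⟩ := exists_dotProduct_eq_of_mem_genSpectrum hμ
  have hpos : 0 < v ⬝ᵥ D *ᵥ v := by simpa using hD.dotProduct_mulVec_pos hv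
  have := h v
  rw [hvμ] at this
  exact le_of_mul_le_mul_right this hpos

theorem le_genSpectrum {A D : Matrix ι ι ℝ} (hD : D.PosDef) {α : ℝ}
    (h : ∀ v, α * (v ⬝ᵥ D *ᵥ v) ≤ v ⬝ᵥ A *ᵥ v) {μ : ℝ} (hμ : μ ∈ genSpectrum A D) : α ≤ μ := by
  obtain ⟨v, hv, hvμ⟩ := exists_dotProduct_eq_of_mem_genSpectrum hμ
  have hpos : 0 < v ⬝ᵥ D *ᵥ v := by simpa using hD.dotProduct_mulVec_pos hv
  have := h v
  rw [hvμ] at this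
  exact le_of_mul_le_mul_right this hpos

theorem genSpectrum_pos {A D : Matrix ι ι ℝ} (hA : A.PosDef) (hD : D.PosDef) {μ : ℝ}
    (hμ : μ ∈ genSpectrum A D) : 0 < μ := by
  obtain ⟨v, hv, hvμ⟩ := exists_dotProduct_eq_of_mem_genSpectrum hμ
  have hposA : 0 < v ⬝ᵥ A *ᵥ v := by simpa using hA.dotProduct_mulVec_pos hv
  have hposD : 0 < v ⬝ᵥ D *ᵥ v := by simpa using hD.dotProduct_mulVec_pos hv
  rw [hvμ] at hposA
  exact pos_of_mul_pos_left hposA hposD.le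

theorem inv_mem_genSpectrum {A D : Matrix ι ι ℝ} {μ : ℝ} (hμ0 : μ ≠ 0)
    (hμ : μ ∈ genSpectrum A D) : μ⁻¹ ∈ genSpectrum D A := by
  intro h
  apply hμ
  have : A - μ • D = (-μ) • (D - μ⁻¹ • A) := by
    rw [smul_sub, smul_smul, neg_mul, mul_inv_cancel₀ hμ0, neg_smul, neg_smul, one_smul]
    abel
  rw [this]
  exact h.smul (Units.mk0 (-μ) (neg_ne_zero.mpr hμ0))

theorem neg_mem_genSpectrum_neg {A D : Matrix ι ι ℝ} {μ : ℝ} :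
    -μ ∈ genSpectrum (-A) D ↔ μ ∈ genSpectrum A D := by
  rw [genSpectrum, genSpectrum, Set.mem_ofPred_eq, Set.mem_ofPred_eq, not_iff_not, neg_smul,
    sub_neg_eq_add, neg_add_eq_sub, ← IsUnit.neg_iff, neg_sub]

theorem isLeast_genSpectrum_neg {A D : Matrix ι ι ℝ} {b : ℝ}
    (h : IsGreatest (genSpectrum A D) b) : IsLeast (genSpectrum (-A) D) (-b) := by
  refine ⟨neg_mem_genSpectrum_neg.mpr h.1, fun x hx => ?_⟩
  have := h.2 (neg_mem_genSpectrum_neg.mp (show -(-x) ∈ _ by rwa [neg_neg]))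
  linarith

theorem isGreatest_genSpectrum_neg {A D : Matrix ι ι ℝ} {a : ℝ}
    (h : IsLeast (genSpectrum A D) a) : IsGreatest (genSpectrum (-A) D) (-a) := by
  refine ⟨neg_mem_genSpectrum_neg.mpr h.1, fun x hx => ?_⟩
  have := h.2 (neg_mem_genSpectrum_neg.mp (show -(-x) ∈ _ by rwa [neg_neg]))
  linarith

theorem isLeast_genSpectrum_swap {A D : Matrix ι ι ℝ} (hA : A.PosDef) (hD : D.PosDef) {b : ℝ}
    (h : IsGreatest (genSpectrum A D) b) : IsLeast (genSpectrum D A) b⁻¹ := by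
  refine ⟨inv_mem_genSpectrum (genSpectrum_pos hA hD h.1).ne' h.1, fun x hx => ?_⟩
  have hx0 := genSpectrum_pos hD hA hx
  exact inv_le_of_inv_le₀ hx0 (h.2 (inv_mem_genSpectrum hx0.ne' hx))

theorem isGreatest_genSpectrum_swap {A D : Matrix ι ι ℝ} (hA : A.PosDef) (hD : D.PosDef) {a : ℝ}
    (h : IsLeast (genSpectrum A D) a) : IsGreatest (genSpectrum D A) a⁻¹ := by
  refine ⟨inv_mem_genSpectrum (genSpectrum_pos hA hD h.1).ne' h.1, fun x hx => ?_⟩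
  have hx0 := genSpectrum_pos hD hA hx
  exact le_inv_of_le_inv₀ (genSpectrum_pos hA hD h.1) (h.2 (inv_mem_genSpectrum hx0.ne' hx))

theorem adiGamma_neg_eq {a b c d : ℝ} (ha : 0 < a) (hb : 0 < b) (hc : 0 < c) (hd : 0 < d) :
    adiGamma a b (-d) (-c) = ((d + a) * (c + b)) / ((d + b) * (c + a)) := by
  have h : ∀ x y : ℝ, 0 < x → 0 < y → |-x - y| = x + y := fun x y hx hy => by
    rw [abs_of_neg (by linarith)]; ring
  rw [adiGamma, h d a hd ha, h c b hc hb, h d b hd hb, h c a hc ha]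

/-- `γ` is a cross-ratio, hence invariant under `x ↦ 1/x`; inversion also swaps the end points of
each interval. -/
theorem adiGamma_inv_eq {a b c d : ℝ} (ha : 0 < a) (hb : 0 < b) (hc : 0 < c) (hd : 0 < d) :
    adiGamma b⁻¹ a⁻¹ (-c⁻¹) (-d⁻¹) = adiGamma a b (-d) (-c) := by
  rw [adiGamma_neg_eq ha hb hc hd, adiGamma_neg_eq (by positivity) (by positivity)
    (by positivity) (by positivity)]
  field_simp
  ring

/-- Here `γ` is the product of `(d + a)/(d + b) ≤ 1` and `(c + b)/(c + a) ≤ b/a`. -/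
theorem adiGamma_neg_le {a b c d : ℝ} (ha : 0 < a) (hab : a ≤ b) (hc : 0 < c) (hd : 0 < d) :
    adiGamma a b (-d) (-c) ≤ b / a := by
  have hb := ha.trans_le hab
  rw [adiGamma_neg_eq ha hb hc hd, div_le_div_iff₀ (by positivity) ha]
  have h1 : 0 ≤ (b - a) * c * d := by
    have : 0 ≤ b - a := by linarith
    positivity
  have h2 : 0 ≤ (b - a) * (a + b) * c := by
    have : 0 ≤ b - a := by linarith
    positivity
  have h3 : 0 ≤ (b - a) * a * b := by
    have : 0 ≤ b - a := by linarith
    positivity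
  nlinarith

theorem adiGamma_neg_pos {a b c d : ℝ} (ha : 0 < a) (hb : 0 < b) (hc : 0 < c) (hd : 0 < d) :
    0 < adiGamma a b (-d) (-c) := by
  rw [adiGamma_neg_eq ha hb hc hd]
  positivity

theorem disjoint_Icc_neg {a b c d : ℝ} (ha : 0 < a) (hc : 0 < c) :
    Disjoint (Set.Icc a b) (Set.Icc (-d) (-c)) := by
  rw [Set.disjoint_left]
  intro x hx hx'
  linarith [hx.1, hx'.2]

/-- For positive definite matrices, the iteration counts for the pencils `(M₁, E₁)`, `(-M₂, E₂)` and
`(E₁, M₁)`, `(-E₂, M₂)` coincide and are controlled by the condition number of `(M₁, E₁)`. -/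
theorem exists_isADIIterationCount {κ : Type*} [Fintype κ] [DecidableEq κ] [Nonempty ι]
    [Nonempty κ] {M₁ E₁ : Matrix ι ι ℝ} {M₂ E₂ : Matrix κ κ ℝ} (hM₁ : M₁.PosDef)
    (hE₁ : E₁.PosDef) (hM₂ : M₂.PosDef) (hE₂ : E₂.PosDef) {α β : ℝ} (hα : 0 < α)
    (hαv : ∀ v, α * (v ⬝ᵥ E₁ *ᵥ v) ≤ v ⬝ᵥ M₁ *ᵥ v)
    (hβv : ∀ v, v ⬝ᵥ M₁ *ᵥ v ≤ β * (v ⬝ᵥ E₁ *ᵥ v)) (ε : ℝ) :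
    ∃ γ : ℝ, 0 < γ ∧ γ ≤ β / α ∧
      IsADIIterationCount M₁ (-M₂) E₂ E₁ ε
        ⌈Real.log (16 * γ) * Real.log (4 / ε) / Real.pi ^ 2⌉₊ ∧
      IsADIIterationCount E₁ (-E₂) M₂ M₁ ε
        ⌈Real.log (16 * γ) * Real.log (4 / ε) / Real.pi ^ 2⌉₊ := by
  obtain ⟨a, b, hla, hgb⟩ := exists_isLeast_isGreatest_genSpectrum hM₁.1 hE₁
  obtain ⟨c, d, hlc, hgd⟩ := exists_isLeast_isGreatest_genSpectrum hM₂.1 hE₂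
  have ha := genSpectrum_pos hM₁ hE₁ hla.1
  have hb := genSpectrum_pos hM₁ hE₁ hgb.1
  have hc := genSpectrum_pos hM₂ hE₂ hlc.1
  have hd := genSpectrum_pos hM₂ hE₂ hgd.1
  have haα := le_genSpectrum hE₁ hαv hla.1
  have hbβ := genSpectrum_le hE₁ hβv hgb.1
  refine ⟨adiGamma a b (-d) (-c), adiGamma_neg_pos ha hb hc hd, ?_, ?_, ?_⟩
  · refine (adiGamma_neg_le ha (hla.2 hgb.1) hc hd).trans ?_
    gcongr
    exact hb.le.trans hbβ
  · exact ⟨a, b, -d, -c, hla, hgb, isLeast_genSpectrum_neg hgd, isGreatest_genSpectrum_neg hlc,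
      disjoint_Icc_neg ha hc, rfl⟩
  · refine ⟨b⁻¹, a⁻¹, -c⁻¹, -d⁻¹, isLeast_genSpectrum_swap hM₁ hE₁ hgb,
      isGreatest_genSpectrum_swap hM₁ hE₁ hla,
      isLeast_genSpectrum_neg (isGreatest_genSpectrum_swap hM₂ hE₂ hlc),
      isGreatest_genSpectrum_neg (isLeast_genSpectrum_swap hM₂ hE₂ hgd),
      disjoint_Icc_neg (by positivity) (by positivity), ?_⟩
    rw [adiGamma_inv_eq ha hb hc hd]

end GeneralizedEigenvalues

/-! ### Gram forms, Poincaré's inequality and the bubble polynomials. -/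

section PiecewisePolynomials

open Polynomial Matrix

/-- The quadratic form of a Gram matrix of piecewise polynomials. -/
theorem dotProduct_gram_mulVec {ι : Type*} [Fintype ι] {A : Matrix ι ι ℝ} {x : ℕ → ℝ} {n : ℕ}
    {P : ι → ℕ → ℝ[X]}
    (hA : ∀ i j, A i j = ∑ c ∈ Finset.range n,
      ∫ t in x c..x (c + 1), (P i c).eval t * (P j c).eval t) (v : ι → ℝ) :
    v ⬝ᵥ A *ᵥ v = ∑ c ∈ Finset.range n,
      ∫ t in x c..x (c + 1), (∑ i, C (v i) * P i c).eval t ^ 2 := by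
  have h : ∀ c, ∫ t in x c..x (c + 1), (∑ i, C (v i) * P i c).eval t ^ 2 =
      ∑ i, ∑ j, v i * v j * ∫ t in x c..x (c + 1), (P i c).eval t * (P j c).eval t := by
    intro c
    have hint : ∀ i j, IntervalIntegrable
        (fun t => v i * v j * ((P i c).eval t * (P j c).eval t)) MeasureTheory.volume
        (x c) (x (c + 1)) := fun i j =>
      (continuous_const.mul ((P i c).continuous.mul (P j c).continuous)).intervalIntegrable _ _
    calc ∫ t in x c..x (c + 1), (∑ i, C (v i) * P i c).eval t ^ 2
        = ∫ t in x c..x (c + 1), ∑ i, ∑ j, v i * v j * ((P i c).eval t * (P j c).eval t) := by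
          congr 1
          ext t
          rw [eval_finsetSum, sq, Finset.sum_mul_sum]
          refine Finset.sum_congr rfl fun i _ => Finset.sum_congr rfl fun j _ => ?_
          rw [eval_C_mul, eval_C_mul]
          ring
      _ = _ := by
          have hint' : ∀ i, IntervalIntegrable
              (fun t => ∑ j, v i * v j * ((P i c).eval t * (P j c).eval t)) MeasureTheory.volume
              (x c) (x (c + 1)) := fun i => (continuous_finsetSum _ fun j _ => continuous_const.mul
                ((P i c).continuous.mul (P j c).continuous)).intervalIntegrable _ _
          rw [intervalIntegral.integral_finsetSum fun i _ => hint' i]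
          refine Finset.sum_congr rfl fun i _ => ?_
          rw [intervalIntegral.integral_finsetSum fun j _ => hint i j]
          refine Finset.sum_congr rfl fun j _ => ?_
          rw [intervalIntegral.integral_const_mul]
  simp only [h, dotProduct, mulVec, hA, Finset.mul_sum, Finset.sum_mul]
  rw [Finset.sum_comm]
  conv_rhs => rw [Finset.sum_comm]
  rw [Finset.sum_comm]
  refine Finset.sum_congr rfl fun i _ => ?_
  conv_rhs => rw [Finset.sum_comm]
  refine Finset.sum_congr rfl fun j _ => Finset.sum_congr rfl fun c _ => ?_
  ring

/-- A Poincaré inequality for continuous piecewise polynomials that vanish at the left end. -/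
theorem sum_integral_sq_le_of_left_eq_zero {x : ℕ → ℝ} {n : ℕ} {q : ℕ → ℝ[X]} {u : ℕ → ℝ}
    (hx : ∀ c < n, x 0 ≤ x c ∧ x c ≤ x (c + 1) ∧ x (c + 1) ≤ x n)
    (hl : ∀ c < n, (q c).eval (x c) = u c) (hr : ∀ c < n, (q c).eval (x (c + 1)) = u (c + 1))
    (h0 : u 0 = 0) :
    ∑ c ∈ Finset.range n, ∫ t in x c..x (c + 1), (q c).eval t ^ 2 ≤
      4 * (x n - x 0) ^ 2 *
        ∑ c ∈ Finset.range n, ∫ t in x c..x (c + 1), (q c).derivative.eval t ^ 2 := by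
  set L := x n - x 0 with hL
  -- The left side telescopes over the cells: the weight `x n - t` kills the right boundary term and
  -- `u 0 = 0` the left one. The shared nodal values `u` encode continuity.
  have key : ∀ c ∈ Finset.range n, (x n - x (c + 1)) * u (c + 1) ^ 2 - (x n - x c) * u c ^ 2 ≤
      2 * L ^ 2 * (∫ t in x c..x (c + 1), (q c).derivative.eval t ^ 2) -
        1 / 2 * ∫ t in x c..x (c + 1), (q c).eval t ^ 2 := by
    intro c hc
    have hc := Finset.mem_range.mp hc
    obtain ⟨hx1, hx2, hx3⟩ := hx c hc
    set r : ℝ[X] := (C (x n) - X) * q c ^ 2 with hrdef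
    have hrd : ∀ t, r.derivative.eval t =
        -(q c).eval t ^ 2 + (x n - t) * (2 * (q c).eval t * (q c).derivative.eval t) := by
      intro t
      simp [hrdef, derivative_mul, derivative_pow]
    have hftc : ∫ t in x c..x (c + 1), r.derivative.eval t =
        (x n - x (c + 1)) * u (c + 1) ^ 2 - (x n - x c) * u c ^ 2 := by
      rw [intervalIntegral.integral_eq_sub_of_hasDerivAt (fun t _ => r.hasDerivAt t)
        (r.derivative.continuous.intervalIntegrable _ _), hrdef]
      simp [hl c hc, hr c hc]
    have hi1 : IntervalIntegrable (fun t => 2 * L ^ 2 * (q c).derivative.eval t ^ 2)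
        MeasureTheory.volume (x c) (x (c + 1)) :=
      (continuous_const.mul ((q c).derivative.continuous.pow 2)).intervalIntegrable _ _
    have hi2 : IntervalIntegrable (fun t => 1 / 2 * (q c).eval t ^ 2)
        MeasureTheory.volume (x c) (x (c + 1)) :=
      (continuous_const.mul ((q c).continuous.pow 2)).intervalIntegrable _ _
    rw [← hftc, ← intervalIntegral.integral_const_mul, ← intervalIntegral.integral_const_mul,
      ← intervalIntegral.integral_sub hi1 hi2]
    apply intervalIntegral.integral_mono_on (μ := MeasureTheory.volume) hx2
      (r.derivative.continuous.intervalIntegrable _ _)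
    · exact hi1.sub hi2
    · intro t ht
      rw [hrd]
      have h1 : (x n - t) ^ 2 ≤ L ^ 2 := by
        apply pow_le_pow_left₀ <;> linarith [ht.1, ht.2]
      have h2 := mul_le_mul_of_nonneg_right h1 (sq_nonneg ((q c).derivative.eval t))
      -- Young's inequality: `2(x n - t) q q' ≤ q²/2 + 2(x n - t)² q'²`.
      nlinarith [sq_nonneg ((q c).eval t - 2 * (x n - t) * (q c).derivative.eval t)]
  have hsum := Finset.sum_le_sum key
  rw [Finset.sum_range_sub (fun c => (x n - x c) * u c ^ 2), Finset.sum_sub_distrib,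
    ← Finset.mul_sum, ← Finset.mul_sum, h0] at hsum
  simp only [sub_self, zero_mul, ne_eq, OfNat.ofNat_ne_zero, not_false_eq_true, zero_pow,
    mul_zero] at hsum
  linarith

/-- The recurrence multiplies the leading coefficient by a positive number. The exact degree makes
the `W k` linearly independent. -/
theorem ultraspherical_natDegree_le_and_coeff_pos {lam : ℝ} (hlam : 0 < lam) (k : ℕ) :
    (ultraspherical lam k).natDegree ≤ k ∧ 0 < (ultraspherical lam k).coeff k := by
  induction k using Nat.twoStepInduction with
  | zero => simp [ultraspherical]
  | one =>
    constructor
    · rw [ultraspherical]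
      exact (natDegree_C_mul_le _ _).trans natDegree_X_le
    · simp [ultraspherical, hlam]
  | more k h0 h1 =>
    rw [ultraspherical]
    constructor
    · refine (natDegree_C_mul_le _ _).trans ((natDegree_sub_le _ _).trans (max_le ?_ ?_))
      · rw [mul_assoc]
        refine (natDegree_C_mul_le _ _).trans (natDegree_mul_le.trans ?_)
        have := natDegree_X_le (R := ℝ)
        omega
      · exact (natDegree_C_mul_le _ _).trans (by omega)
    · rw [coeff_C_mul, coeff_sub, coeff_C_mul, mul_assoc, coeff_C_mul, coeff_X_mul,
        coeff_eq_zero_of_natDegree_lt (show (ultraspherical lam k).natDegree < k + 2 by omega)]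
      have := h1.2
      rw [mul_zero, sub_zero]
      positivity

theorem W_natDegree_le (k : ℕ) : (W k).natDegree ≤ k + 2 := by
  rw [W]
  refine (natDegree_C_mul_le _ _).trans (natDegree_mul_le.trans ?_)
  have h1 := (ultraspherical_natDegree_le_and_coeff_pos (lam := 3 / 2) (by norm_num) k).1
  have h2 : (1 - X ^ 2 : ℝ[X]).natDegree ≤ 2 := by compute_degree
  omega

theorem W_coeff_ne_zero (k : ℕ) : (W k).coeff (k + 2) ≠ 0 := by
  obtain ⟨h1, h2⟩ := ultraspherical_natDegree_le_and_coeff_pos (lam := 3 / 2) (by norm_num) k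
  rw [W, coeff_C_mul, sub_mul, one_mul, coeff_sub, coeff_X_pow_mul,
    coeff_eq_zero_of_natDegree_lt (show (ultraspherical (3 / 2) k).natDegree < k + 2 by omega)]
  have h3 : (0 : ℝ) < 1 / (((k : ℝ) + 1) * ((k : ℝ) + 2)) := by positivity
  rw [zero_sub, mul_neg]
  exact (neg_neg_of_pos (mul_pos h3 h2)).ne

theorem W_eval_eq_zero (k : ℕ) {y : ℝ} (hy : y ^ 2 = 1) : (W k).eval y = 0 := by
  simp [W, hy]

/-- The degrees `k + 2` are distinct, so the top coefficient isolates the last summand. -/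
theorem eq_zero_of_sum_W_eq_zero {m : ℕ} {a : Fin m → ℝ}
    (h : ∑ k, C (a k) * W (k : ℕ) = 0) : a = 0 := by
  induction m with
  | zero => exact Subsingleton.elim _ _
  | succ m ih =>
    rw [Fin.sum_univ_castSucc] at h
    have hlast : a (Fin.last m) = 0 := by
      have hc := congrArg (fun r => r.coeff (m + 2)) h
      simp only [coeff_add, finsetSum_coeff, coeff_C_mul, Fin.val_last, coeff_zero,
        Fin.val_castSucc] at hc
      rw [Finset.sum_eq_zero, zero_add] at hc
      · exact (mul_eq_zero.mp hc).resolve_right (W_coeff_ne_zero m)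
      · intro k _
        rw [coeff_eq_zero_of_natDegree_lt, mul_zero]
        have := W_natDegree_le (k : ℕ)
        omega
    rw [hlast] at h
    simp only [map_zero, zero_mul, add_zero, Fin.val_castSucc] at h
    have := ih (a := fun k => a k.castSucc) h
    ext k
    refine Fin.lastCases hlast (fun k => congrFun this k) k

/-! ### Hats and bubbles cell by cell, and their values at the nodes. -/

namespace Subdivision

variable {a b : ℝ} (T : Subdivision a b)

theorem node_lt_node {i j : ℕ} (hij : i < j) (hj : j ≤ T.n) : T.node i < T.node j := by
  induction j, hij using Nat.le_induction with
  | base => exact T.node_lt i hj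
  | succ j hij ih => exact (ih (by omega)).trans (T.node_lt j hj)

theorem node_le_node {i j : ℕ} (hij : i ≤ j) (hj : j ≤ T.n) : T.node i ≤ T.node j := by
  rcases hij.eq_or_lt with rfl | h
  · exact le_rfl
  · exact (T.node_lt_node h hj).le

theorem node_lt_node_iff {i j : ℕ} (hi : i ≤ T.n) (hj : j ≤ T.n) :
    T.node i < T.node j ↔ i < j := by
  refine ⟨fun h => ?_, fun h => T.node_lt_node h hj⟩
  by_contra! hc
  exact absurd (T.node_le_node hc hi) (not_le.mpr h)

theorem node_le_node_iff {i j : ℕ} (hi : i ≤ T.n) (hj : j ≤ T.n) :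
    T.node i ≤ T.node j ↔ i ≤ j := by
  rw [← not_lt, ← not_lt, T.node_lt_node_iff hj hi]

theorem n_pos (hab : a < b) : 0 < T.n := by
  rcases Nat.eq_zero_or_pos T.n with h | h
  · have h1 := T.node_last
    rw [h, T.node_zero] at h1
    exact absurd h1 hab.ne
  · exact h

theorem cellLength_pos {c : ℕ} (hc : c < T.n) : 0 < T.cellLength c :=
  sub_pos.mpr (T.node_lt c hc)

/-- The integral of a function that is polynomial on each cell. -/
theorem integral_eq_sum {f : ℝ → ℝ} {r : ℕ → ℝ → ℝ} (hr : ∀ c, Continuous (r c))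
    (h : ∀ c < T.n, ∀ t ∈ Set.Ioo (T.node c) (T.node (c + 1)), f t = r c t) :
    ∫ t in a..b, f t = ∑ c ∈ Finset.range T.n, ∫ t in T.node c..T.node (c + 1), r c t := by
  have hint : ∀ c < T.n, IntervalIntegrable f MeasureTheory.volume (T.node c)
      (T.node (c + 1)) := by
    intro c hc
    refine ((hr c).intervalIntegrable _ _).congr_uIoo fun t ht => ?_
    rw [Set.uIoo_of_le (T.node_lt c hc).le] at ht
    exact (h c hc t ht).symm
  have hsum := intervalIntegral.sum_integral_adjacent_intervals hint
  rw [T.node_zero, T.node_last] at hsum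
  rw [← hsum]
  refine Finset.sum_congr rfl fun c hc => ?_
  have hc := Finset.mem_range.mp hc
  exact intervalIntegral.integral_congr_Ioo_of_le (T.node_lt c hc).le fun t ht => h c hc t ht

/-- The restriction of the hat function `h_m` to the cell `c`. -/
noncomputable def hatPoly (m c : ℕ) : ℝ[X] :=
  if c + 1 = m then C (1 / (T.node (c + 1) - T.node c)) * (X - C (T.node c))
  else if c = m then C (1 / (T.node (c + 1) - T.node c)) * (C (T.node (c + 1)) - X)
  else 0

/-- The affine map from the cell `c` to `[-1,1]`. -/
noncomputable def cellMap (c : ℕ) : ℝ[X] :=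
  C (2 / (T.node (c + 1) - T.node c)) * X +
    C (-(T.node c + T.node (c + 1)) / (T.node (c + 1) - T.node c))

theorem cellMap_eval (c : ℕ) (t : ℝ) : (T.cellMap c).eval t =
    (2 * t - T.node c - T.node (c + 1)) / (T.node (c + 1) - T.node c) := by
  simp only [cellMap, eval_add, eval_mul, eval_C, eval_X]
  ring

/-- The restriction of the bubble function of degree `k + 2` on the cell `j` to the cell `c`. -/
noncomputable def bubblePoly (k j c : ℕ) : ℝ[X] :=
  if c = j then (W k).comp (T.cellMap c) else 0

theorem hat_eq {m c : ℕ} (hm : m ≤ T.n) (hc : c < T.n) {t : ℝ}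
    (ht : t ∈ Set.Icc (T.node c) (T.node (c + 1))) : T.hat m t = (T.hatPoly m c).eval t := by
  have hcc := T.node_lt c hc
  have hne : T.node (c + 1) - T.node c ≠ 0 := (sub_pos.mpr hcc).ne'
  rw [hatPoly]
  split_ifs with h1 h2
  · subst h1
    rw [hat, if_pos ⟨by omega, by simpa using ht⟩]
    simp
    ring
  · subst h2
    rw [hat]
    split_ifs with h3 h4
    -- `hat` tests the left cell first; here both branches apply only at the peak, where both equal
    -- `1`.
    · have hlt := T.node_lt_node (show c - 1 < c by omega) hc.le
      have htc : t = T.node c := le_antisymm h3.2.2 ht.1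
      rw [htc, div_self (sub_pos.mpr hlt).ne']
      simp
      field_simp
    · simp
      ring
    · exact absurd ⟨hc, ht⟩ h4
  · rw [hat, eval_zero]
    split_ifs with h3 h4
    · have h5 : c + 1 ≤ m - 1 := by
        by_contra! hlt
        have := T.node_lt_node (show m < c by omega) hc.le
        linarith [h3.2.2, ht.1]
      have := T.node_le_node h5 (by omega)
      have h6 : t = T.node (m - 1) := le_antisymm (ht.2.trans this) h3.2.1
      rw [h6, sub_self, zero_div]
    · have h5 : m + 1 ≤ c := by
        by_contra! hlt
        have := T.node_lt_node (show c + 1 < m by omega) hm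
        linarith [h4.2.1, ht.2]
      have := T.node_le_node h5 hc.le
      have h6 : t = T.node (m + 1) := le_antisymm h4.2.2 (this.trans ht.1)
      rw [h6, sub_self, zero_div]
    · rfl

theorem W_eval_left (k : ℕ) {j : ℕ} (hj : j < T.n) :
    (W k).eval ((2 * T.node j - T.node j - T.node (j + 1)) / (T.node (j + 1) - T.node j)) = 0 := by
  have hne : T.node (j + 1) - T.node j ≠ 0 := (sub_pos.mpr (T.node_lt j hj)).ne'
  apply W_eval_eq_zero
  field_simp
  ring

theorem W_eval_right (k : ℕ) {j : ℕ} (hj : j < T.n) :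
    (W k).eval ((2 * T.node (j + 1) - T.node j - T.node (j + 1)) /
      (T.node (j + 1) - T.node j)) = 0 := by
  have hne : T.node (j + 1) - T.node j ≠ 0 := (sub_pos.mpr (T.node_lt j hj)).ne'
  apply W_eval_eq_zero
  field_simp
  ring

/-- Distinct closed cells meet in at most a common end point, where `W k` vanishes. -/
theorem bubble_eq {k j c : ℕ} (hj : j < T.n) (hc : c < T.n) {t : ℝ}
    (ht : t ∈ Set.Icc (T.node c) (T.node (c + 1))) :
    T.bubble k j t = (T.bubblePoly k j c).eval t := by
  rw [bubblePoly]
  split_ifs with h1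
  · subst h1
    rw [bubble, if_pos ht, eval_comp, cellMap_eval]
  · rw [bubble, eval_zero]
    split_ifs with h2
    · rcases lt_or_gt_of_ne h1 with h | h
      · have := T.node_le_node (show c + 1 ≤ j by omega) hj.le
        rw [show t = T.node j from le_antisymm (ht.2.trans this) h2.1]
        exact T.W_eval_left k hj
      · have := T.node_le_node (show j + 1 ≤ c by omega) hc.le
        rw [show t = T.node (j + 1) from le_antisymm h2.2 (this.trans ht.1)]
        exact T.W_eval_right k hj
    · rfl

theorem hat_node (hn : 0 < T.n) {m i : ℕ} (hm : m ≤ T.n) (hi : i ≤ T.n) :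
    T.hat m (T.node i) = if m = i then 1 else 0 := by
  rw [hat]
  split_ifs with h1 h2 h2 h3 h3
  · subst h2
    exact div_self (sub_pos.mpr (T.node_lt_node (by omega) hm)).ne'
  · have h3 := (T.node_le_node_iff (by omega) hi).mp h1.2.1
    have h4 := (T.node_le_node_iff hi hm).mp h1.2.2
    rw [show m - 1 = i by omega, sub_self, zero_div]
  · subst h3
    exact div_self (sub_pos.mpr (T.node_lt m h2.1)).ne'
  · have h4 := (T.node_le_node_iff hm hi).mp h2.2.1
    have h5 := (T.node_le_node_iff hi (by omega)).mp h2.2.2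
    rw [show m + 1 = i by omega, sub_self, zero_div]
  · subst h3
    exfalso
    rcases Nat.eq_zero_or_pos m with h | h
    · exact h2 ⟨by omega, le_rfl, T.node_le_node (by omega) (by omega)⟩
    · exact h1 ⟨h, T.node_le_node (by omega) hm, le_rfl⟩
  · rfl

theorem bubble_node {k j i : ℕ} (hj : j < T.n) (hi : i ≤ T.n) :
    T.bubble k j (T.node i) = 0 := by
  rw [bubble]
  split_ifs with h
  · have h1 := (T.node_le_node_iff hj.le hi).mp h.1
    have h2 := (T.node_le_node_iff hi hj).mp h.2
    rcases (show i = j ∨ i = j + 1 by omega) with rfl | rfl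
    · exact T.W_eval_left k hj
    · exact T.W_eval_right k hj
  · rfl

theorem hatPoly_natDegree_le (m c : ℕ) : (T.hatPoly m c).natDegree ≤ 1 := by
  rw [hatPoly]
  split_ifs
  · exact (natDegree_C_mul_le _ _).trans (by compute_degree)
  · exact (natDegree_C_mul_le _ _).trans (by compute_degree)
  · simp

theorem bubblePoly_natDegree_le (k j c : ℕ) : (T.bubblePoly k j c).natDegree ≤ k + 2 := by
  rw [bubblePoly]
  split_ifs
  · refine natDegree_comp_le.trans ((Nat.mul_le_mul (W_natDegree_le k)
      (show (T.cellMap c).natDegree ≤ 1 from natDegree_linear_le)).trans ?_)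
    omega
  · simp

end Subdivision

end PiecewisePolynomials

/-! ### Quadratic forms of the mass, stiffness and energy matrices. -/

section Assembly

open Polynomial Matrix

variable {a b : ℝ}

/-- The restriction of a basis function to the cell `c`. -/
noncomputable def cellPoly (bc : BoundaryCondition) (T : Subdivision a b) (p : ℕ) :
    Dof bc T.n p → ℕ → ℝ[X]
  | .inl j, c => T.hatPoly (firstHat bc + j) c
  | .inr (k, j), c => T.bubblePoly k j c

theorem firstHat_add_le {bc : BoundaryCondition} {n : ℕ} (j : Fin (numHats bc n)) :
    firstHat bc + j ≤ n := by
  obtain ⟨j, hj⟩ := j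
  cases bc <;> simp only [numHats, firstHat] at hj ⊢ <;> omega

theorem basisFun_eq (bc : BoundaryCondition) (T : Subdivision a b) (p : ℕ) (i : Dof bc T.n p)
    {c : ℕ} (hc : c < T.n) {t : ℝ} (ht : t ∈ Set.Icc (T.node c) (T.node (c + 1))) :
    basisFun bc T p i t = (cellPoly bc T p i c).eval t := by
  rcases i with j | ⟨k, j⟩
  · exact T.hat_eq (firstHat_add_le j) hc ht
  · exact T.bubble_eq j.2 hc ht

theorem deriv_basisFun_eq (bc : BoundaryCondition) (T : Subdivision a b) (p : ℕ)
    (i : Dof bc T.n p) {c : ℕ} (hc : c < T.n) {t : ℝ}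
    (ht : t ∈ Set.Ioo (T.node c) (T.node (c + 1))) :
    deriv (basisFun bc T p i) t = (cellPoly bc T p i c).derivative.eval t := by
  have h : basisFun bc T p i =ᶠ[nhds t] fun s => (cellPoly bc T p i c).eval s := by
    filter_upwards [Ioo_mem_nhds ht.1 ht.2] with s hs
    exact basisFun_eq bc T p i hc (Set.Ioo_subset_Icc_self hs)
  rw [h.deriv_eq, Polynomial.deriv]

theorem cellPoly_natDegree_le (bc : BoundaryCondition) (T : Subdivision a b) {p : ℕ} (hp : 1 ≤ p)
    (i : Dof bc T.n p) (c : ℕ) : (cellPoly bc T p i c).natDegree ≤ p := by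
  rcases i with j | ⟨k, j⟩
  · exact (T.hatPoly_natDegree_le _ _).trans hp
  · refine (T.bubblePoly_natDegree_le _ _ _).trans ?_
    have := k.2
    omega

/-- The restriction to the cell `c` of the function with coefficient vector `v`. -/
noncomputable def cellFun (bc : BoundaryCondition) (T : Subdivision a b) (p : ℕ)
    (v : Dof bc T.n p → ℝ) (c : ℕ) : ℝ[X] :=
  ∑ i, C (v i) * cellPoly bc T p i c

theorem cellFun_natDegree_le (bc : BoundaryCondition) (T : Subdivision a b) {p : ℕ} (hp : 1 ≤ p)
    (v : Dof bc T.n p → ℝ) (c : ℕ) : (cellFun bc T p v c).natDegree ≤ p :=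
  natDegree_sum_le_of_forall_le _ _ fun i _ =>
    (natDegree_C_mul_le _ _).trans (cellPoly_natDegree_le bc T hp i c)

theorem cellFun_eval (bc : BoundaryCondition) (T : Subdivision a b) (p : ℕ)
    (v : Dof bc T.n p → ℝ) {c : ℕ} (hc : c < T.n) {t : ℝ}
    (ht : t ∈ Set.Icc (T.node c) (T.node (c + 1))) :
    (cellFun bc T p v c).eval t = ∑ i, v i * basisFun bc T p i t := by
  rw [cellFun, eval_finsetSum]
  refine Finset.sum_congr rfl fun i _ => ?_
  rw [eval_C_mul, basisFun_eq bc T p i hc ht]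

theorem massMatrix_quadForm (bc : BoundaryCondition) (T : Subdivision a b) (p : ℕ)
    (v : Dof bc T.n p → ℝ) :
    v ⬝ᵥ massMatrix bc T p *ᵥ v = ∑ c ∈ Finset.range T.n,
      ∫ t in T.node c..T.node (c + 1), (cellFun bc T p v c).eval t ^ 2 := by
  refine dotProduct_gram_mulVec (fun i j => ?_) v
  rw [massMatrix, Matrix.of_apply]
  refine T.integral_eq_sum
    (fun c => (cellPoly bc T p i c).continuous.mul (cellPoly bc T p j c).continuous) ?_
  intro c hc t ht
  rw [basisFun_eq bc T p i hc (Set.Ioo_subset_Icc_self ht),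
    basisFun_eq bc T p j hc (Set.Ioo_subset_Icc_self ht)]

theorem stiffnessMatrix_quadForm (bc : BoundaryCondition) (T : Subdivision a b) (p : ℕ)
    (v : Dof bc T.n p → ℝ) :
    v ⬝ᵥ stiffnessMatrix bc T p *ᵥ v = ∑ c ∈ Finset.range T.n,
      ∫ t in T.node c..T.node (c + 1), (cellFun bc T p v c).derivative.eval t ^ 2 := by
  have h : ∀ c, (cellFun bc T p v c).derivative =
      ∑ i, C (v i) * (cellPoly bc T p i c).derivative := by
    intro c
    simp [cellFun]
  simp only [h]
  refine dotProduct_gram_mulVec (P := fun i c => (cellPoly bc T p i c).derivative)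
    (fun i j => ?_) v
  rw [stiffnessMatrix, Matrix.of_apply]
  refine T.integral_eq_sum (fun c => (cellPoly bc T p i c).derivative.continuous.mul
    (cellPoly bc T p j c).derivative.continuous) ?_
  intro c hc t ht
  rw [deriv_basisFun_eq bc T p i hc ht, deriv_basisFun_eq bc T p j hc ht]

theorem energyMatrix_quadForm (bc : BoundaryCondition) (ω : ℝ) (T : Subdivision a b) (p : ℕ)
    (v : Dof bc T.n p → ℝ) :
    v ⬝ᵥ energyMatrix bc ω T p *ᵥ v =
      v ⬝ᵥ stiffnessMatrix bc T p *ᵥ v + ω ^ 2 / 2 * (v ⬝ᵥ massMatrix bc T p *ᵥ v) := by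
  rw [energyMatrix, Matrix.add_mulVec, dotProduct_add, Matrix.smul_mulVec, dotProduct_smul,
    smul_eq_mul]

theorem massMatrix_isHermitian (bc : BoundaryCondition) (T : Subdivision a b) (p : ℕ) :
    (massMatrix bc T p).IsHermitian := by
  ext i j
  simp [massMatrix, mul_comm]

theorem energyMatrix_isHermitian (bc : BoundaryCondition) (ω : ℝ) (T : Subdivision a b) (p : ℕ) :
    (energyMatrix bc ω T p).IsHermitian := by
  ext i j
  simp [energyMatrix, stiffnessMatrix, massMatrix, mul_comm]

theorem sum_integral_sq_nonneg (T : Subdivision a b) (q : ℕ → ℝ[X]) :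
    ∀ c ∈ Finset.range T.n, 0 ≤ ∫ t in T.node c..T.node (c + 1), (q c).eval t ^ 2 :=
  fun c hc => intervalIntegral.integral_nonneg (T.node_lt c (Finset.mem_range.mp hc)).le
    fun _ _ => sq_nonneg _

theorem massMatrix_quadForm_nonneg (bc : BoundaryCondition) (T : Subdivision a b) (p : ℕ)
    (v : Dof bc T.n p → ℝ) : 0 ≤ v ⬝ᵥ massMatrix bc T p *ᵥ v := by
  rw [massMatrix_quadForm]
  exact Finset.sum_nonneg (sum_integral_sq_nonneg T _)

theorem stiffnessMatrix_quadForm_nonneg (bc : BoundaryCondition) (T : Subdivision a b) (p : ℕ)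
    (v : Dof bc T.n p → ℝ) : 0 ≤ v ⬝ᵥ stiffnessMatrix bc T p *ᵥ v := by
  rw [stiffnessMatrix_quadForm]
  exact Finset.sum_nonneg (sum_integral_sq_nonneg T fun c => (cellFun bc T p v c).derivative)

/-- The basis functions are linearly independent. -/
theorem eq_zero_of_cellFun_eq_zero (hab : a < b) (bc : BoundaryCondition) (T : Subdivision a b)
    (p : ℕ) {v : Dof bc T.n p → ℝ} (h : ∀ c < T.n, cellFun bc T p v c = 0) : v = 0 := by
  have hn := T.n_pos hab
  have hnode : ∀ m ≤ T.n, ∑ i, v i * basisFun bc T p i (T.node m) = 0 := by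
    intro m hm
    rcases hm.eq_or_lt with hm' | hm'
    · have hc : T.n - 1 < T.n := by omega
      have hc' : m = T.n - 1 + 1 := by omega
      have := cellFun_eval bc T p v hc (t := T.node m)
        ⟨T.node_le_node (by omega) hm, by rw [← hc']⟩
      rw [← this, h _ hc, eval_zero]
    · have := cellFun_eval bc T p v hm' (t := T.node m) ⟨le_rfl, (T.node_lt m hm').le⟩
      rw [← this, h _ hm', eval_zero]
  -- At a node all bubbles vanish and exactly one hat equals `1`, so nodal values read off the hat
  -- coefficients.
  have hhat : ∀ j, v (.inl j) = 0 := by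
    intro j
    have hj := hnode _ (firstHat_add_le j)
    rw [Fintype.sum_sum_type, Finset.sum_eq_single j, Finset.sum_eq_zero, add_zero] at hj
    · have h1 := T.hat_node hn (firstHat_add_le j) (firstHat_add_le j)
      rw [if_pos rfl] at h1
      change v (.inl j) * T.hat (firstHat bc + j) (T.node (firstHat bc + j)) = 0 at hj
      rwa [h1, mul_one] at hj
    · rintro ⟨k, c⟩ -
      change _ * T.bubble k c _ = 0
      rw [T.bubble_node c.2 (firstHat_add_le j), mul_zero]
    · intro j' _ hne
      change _ * T.hat (firstHat bc + j') _ = 0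
      rw [T.hat_node hn (firstHat_add_le j') (firstHat_add_le j), if_neg, mul_zero]
      intro he
      exact hne (Fin.ext (by omega))
    · simp
  have hbub : ∀ (c : Fin T.n) (k : Fin (p - 1)), v (.inr (k, c)) = 0 := by
    intro c
    have hc := h c c.2
    rw [cellFun, Fintype.sum_sum_type, Finset.sum_eq_zero (fun j _ => by
      rw [hhat j, C_0, zero_mul]), zero_add, Fintype.sum_prod_type] at hc
    have hsum : (∑ k : Fin (p - 1), C (v (.inr (k, c))) * W (k : ℕ)).comp (T.cellMap c) = 0 := by
      rw [← hc, Polynomial.sum_comp]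
      refine Finset.sum_congr rfl fun k _ => ?_
      rw [Finset.sum_eq_single c]
      · simp [cellPoly, Subdivision.bubblePoly]
      · intro j _ hj
        have : (c : ℕ) ≠ j := fun he => hj (Fin.ext he.symm)
        simp [cellPoly, Subdivision.bubblePoly, this]
      · simp
    have hzero : ∑ k : Fin (p - 1), C (v (.inr (k, c))) * W (k : ℕ) = 0 := by
      have hne : T.node (c + 1) - T.node c ≠ 0 := (sub_pos.mpr (T.node_lt c c.2)).ne'
      refine Polynomial.funext fun y => ?_
      -- The evaluation point is the preimage of `y` under `cellMap`.
      have := congrArg (fun r => r.eval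
        ((y * (T.node (c + 1) - T.node c) + T.node c + T.node (c + 1)) / 2)) hsum
      simp only [eval_comp, T.cellMap_eval, eval_zero] at this ⊢
      rw [← this]
      congr 1
      field_simp
      ring
    exact fun k => congrFun (eq_zero_of_sum_W_eq_zero hzero) k
  ext i
  rcases i with j | ⟨k, c⟩
  · exact hhat j
  · exact hbub c k

theorem massMatrix_posDef (hab : a < b) (bc : BoundaryCondition) (T : Subdivision a b) (p : ℕ) :
    (massMatrix bc T p).PosDef := by
  refine Matrix.PosDef.of_dotProduct_mulVec_pos (massMatrix_isHermitian bc T p) fun v hv => ?_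
  rw [star_trivial]
  refine (massMatrix_quadForm_nonneg bc T p v).lt_of_ne fun h0 => hv ?_
  rw [massMatrix_quadForm] at h0
  have := (Finset.sum_eq_zero_iff_of_nonneg (sum_integral_sq_nonneg T _)).mp h0.symm
  exact eq_zero_of_cellFun_eq_zero hab bc T p fun c hc =>
    eq_zero_of_integral_sq_eq_zero (T.node_lt c hc) (this c (Finset.mem_range.mpr hc))

/-- The Poincaré inequality for the Dirichlet basis. -/
theorem massMatrix_quadForm_le_of_dirichlet (hab : a < b) (T : Subdivision a b) (p : ℕ)
    (v : Dof .dirichlet T.n p → ℝ) :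
    v ⬝ᵥ massMatrix .dirichlet T p *ᵥ v ≤
      4 * (b - a) ^ 2 * (v ⬝ᵥ stiffnessMatrix .dirichlet T p *ᵥ v) := by
  rw [massMatrix_quadForm, stiffnessMatrix_quadForm]
  have := sum_integral_sq_le_of_left_eq_zero (x := T.node) (n := T.n)
    (q := cellFun .dirichlet T p v)
    (u := fun m => ∑ i, v i * basisFun .dirichlet T p i (T.node m))
    (fun c hc => ⟨T.node_le_node (by omega) hc.le, (T.node_lt c hc).le,
      T.node_le_node (by omega) le_rfl⟩)
    (fun c hc => cellFun_eval _ T p v hc ⟨le_rfl, (T.node_lt c hc).le⟩)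
    (fun c hc => cellFun_eval _ T p v hc ⟨(T.node_lt c hc).le, le_rfl⟩)
    -- The function vanishes at `a` because the Dirichlet hats start at index `1`.
    (by
      have hn := T.n_pos hab
      refine Finset.sum_eq_zero fun i _ => ?_
      rcases i with j | ⟨k, c⟩
      · change _ * T.hat (firstHat .dirichlet + j) _ = 0
        rw [T.hat_node hn (firstHat_add_le j) (by omega), if_neg (by simp [firstHat]), mul_zero]
      · change _ * T.bubble k c _ = 0
        rw [T.bubble_node c.2 (by omega), mul_zero])
  rwa [T.node_zero, T.node_last] at this

/-- The worst case is Dirichlet, where the dimension is `pn - 1`; being at least `1`, its double is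
at least `pn`. -/
theorem mul_le_two_mul_numDof (hab : a < b) (bc : BoundaryCondition) (T : Subdivision a b) {p : ℕ}
    (hp : 1 ≤ p) (hN : 1 ≤ numDof bc T p) : p * T.n ≤ 2 * numDof bc T p := by
  have hn := T.n_pos hab
  have h : p * T.n = (p - 1) * T.n + T.n := by
    obtain ⟨m, rfl⟩ : ∃ m, p = m + 1 := ⟨p - 1, by omega⟩
    simp [add_mul]
  rw [h]
  simp only [numDof, Dof, Fintype.card_sum, Fintype.card_fin, Fintype.card_prod] at hN ⊢
  cases bc <;> simp only [numHats] at hN ⊢ <;> omega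

/-- Summing the quasi-uniformity bound over all cells bounds each cell length below by a multiple of
`1/n`. -/
theorem mul_sub_le_n_mul_cellLength {T : Subdivision a b} {ρ : ℝ}
    (h : ∀ i < T.n, ∀ j < T.n, ρ * T.cellLength j ≤ T.cellLength i) {c : ℕ} (hc : c < T.n) :
    ρ * (b - a) ≤ T.n * T.cellLength c := by
  have h1 : ∑ j ∈ Finset.range T.n, T.cellLength j = b - a := by
    simp only [Subdivision.cellLength]
    rw [Finset.sum_range_sub, T.node_zero, T.node_last]
  rw [← h1, Finset.mul_sum]
  refine (Finset.sum_le_sum fun j hj => h c hc j (Finset.mem_range.mp hj)).trans_eq ?_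
  simp

/-- The inverse inequality on a quasi-uniform mesh. -/
theorem stiffnessMatrix_quadForm_le (hab : a < b) (bc : BoundaryCondition) {T : Subdivision a b}
    {ρ : ℝ} (hρ : 0 < ρ) (h : ∀ i < T.n, ∀ j < T.n, ρ * T.cellLength j ≤ T.cellLength i) {p : ℕ}
    (hp : 1 ≤ p) (hN : 1 ≤ numDof bc T p) (v : Dof bc T.n p → ℝ) :
    v ⬝ᵥ stiffnessMatrix bc T p *ᵥ v ≤ 2 ^ 15 / (ρ * (b - a)) ^ 2 * (numDof bc T p : ℝ) ^ 6 *
      (v ⬝ᵥ massMatrix bc T p *ᵥ v) := by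
  rw [massMatrix_quadForm, stiffnessMatrix_quadForm, Finset.mul_sum]
  refine Finset.sum_le_sum fun c hc => ?_
  have hI := sum_integral_sq_nonneg T (cellFun bc T p v) c hc
  have hc := Finset.mem_range.mp hc
  refine (integral_derivative_sq_le hp (cellFun_natDegree_le bc T hp v c) (T.node_lt c hc)).trans ?_
  refine mul_le_mul_of_nonneg_right ?_ hI
  have hl := T.cellLength_pos hc
  have hn1 : (1 : ℝ) ≤ T.n := by exact_mod_cast T.n_pos hab
  have hr : 0 < ρ * (b - a) := mul_pos hρ (sub_pos.mpr hab)
  -- The natural power `n²` is enlarged to `n⁶` so that it merges with `p⁶` into `(pn)⁶ ≤ (2N)⁶`;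
  -- then `2¹⁵ = 512 · 2⁶`.
  have h1 : (ρ * (b - a)) ^ 2 ≤ (T.n : ℝ) ^ 6 * T.cellLength c ^ 2 := by
    calc (ρ * (b - a)) ^ 2 ≤ (T.n * T.cellLength c) ^ 2 :=
          pow_le_pow_left₀ hr.le (mul_sub_le_n_mul_cellLength h hc) 2
      _ = (T.n : ℝ) ^ 2 * T.cellLength c ^ 2 := by ring
      _ ≤ _ := by
        gcongr
        norm_num
  have h2 : (p : ℝ) * T.n ≤ 2 * numDof bc T p := by
    exact_mod_cast mul_le_two_mul_numDof hab bc T hp hN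
  change 512 * (p : ℝ) ^ 6 / T.cellLength c ^ 2 ≤ _
  rw [div_mul_eq_mul_div, div_le_div_iff₀ (by positivity) (by positivity)]
  calc 512 * (p : ℝ) ^ 6 * (ρ * (b - a)) ^ 2
      ≤ 512 * (p : ℝ) ^ 6 * ((T.n : ℝ) ^ 6 * T.cellLength c ^ 2) := by gcongr
    _ = 512 * (p * T.n) ^ 6 * T.cellLength c ^ 2 := by ring
    _ ≤ 512 * (2 * numDof bc T p) ^ 6 * T.cellLength c ^ 2 := by gcongr
    _ = _ := by ring

/-- Spectral equivalence of mass and energy matrices on a quasi-uniform family of meshes, up to a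
power of the number of degrees of freedom. -/
theorem QuasiUniform.exists_spectral_bounds (hab : a < b) (bc : BoundaryCondition) (ω : ℝ)
    (hω : bc = .neumann → ω ≠ 0) {𝒯 : Set (Subdivision a b)} (h𝒯 : QuasiUniform 𝒯) :
    ∃ C : ℝ, 0 < C ∧ ∀ T ∈ 𝒯, ∀ p : ℕ, 1 ≤ p → 1 ≤ numDof bc T p →
      (∀ v, v ⬝ᵥ massMatrix bc T p *ᵥ v ≤ C * (v ⬝ᵥ energyMatrix bc ω T p *ᵥ v)) ∧
      ∀ v, v ⬝ᵥ energyMatrix bc ω T p *ᵥ v ≤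
        C * (numDof bc T p : ℝ) ^ 6 * (v ⬝ᵥ massMatrix bc T p *ᵥ v) := by
  obtain ⟨ρ, hρ, hqu⟩ := h𝒯
  have hba : 0 < b - a := sub_pos.mpr hab
  obtain ⟨C₁, hC₁, hmass⟩ : ∃ C₁ : ℝ, 0 < C₁ ∧ ∀ (T : Subdivision a b) (p : ℕ) v,
      v ⬝ᵥ massMatrix bc T p *ᵥ v ≤ C₁ * (v ⬝ᵥ energyMatrix bc ω T p *ᵥ v) := by
    cases bc with
    | dirichlet =>
      refine ⟨4 * (b - a) ^ 2, by positivity, fun T p v => ?_⟩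
      refine (massMatrix_quadForm_le_of_dirichlet hab T p v).trans ?_
      rw [energyMatrix_quadForm]
      have := massMatrix_quadForm_nonneg .dirichlet T p v
      gcongr
      exact le_add_of_nonneg_right (by positivity)
    | neumann =>
      have hω := hω rfl
      refine ⟨2 / ω ^ 2, by positivity, fun T p v => ?_⟩
      have hS := stiffnessMatrix_quadForm_nonneg .neumann T p v
      rw [energyMatrix_quadForm, mul_add, ← mul_assoc,
        show 2 / ω ^ 2 * (ω ^ 2 / 2) = 1 by field_simp, one_mul]
      exact le_add_of_nonneg_left (by positivity)
  set C₂ := 2 ^ 15 / (ρ * (b - a)) ^ 2 with hC₂def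
  have hC₂ : 0 < C₂ := by positivity
  have hω2 : 0 ≤ ω ^ 2 / 2 := by positivity
  refine ⟨C₁ + C₂ + ω ^ 2 / 2, by positivity, fun T hT p hp hN => ⟨fun v => ?_, fun v => ?_⟩⟩
  · refine (hmass T p v).trans (mul_le_mul_of_nonneg_right (by linarith) ?_)
    have h1 := massMatrix_quadForm_nonneg bc T p v
    have h2 := stiffnessMatrix_quadForm_nonneg bc T p v
    rw [energyMatrix_quadForm]
    positivity
  · have h1 := massMatrix_quadForm_nonneg bc T p v
    have h2 := stiffnessMatrix_quadForm_le hab bc hρ (hqu T hT) hp hN v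
    have hN1 : (1 : ℝ) ≤ (numDof bc T p : ℝ) ^ 6 := one_le_pow₀ (by exact_mod_cast hN)
    rw [energyMatrix_quadForm]
    calc _ ≤ C₂ * (numDof bc T p : ℝ) ^ 6 * (v ⬝ᵥ massMatrix bc T p *ᵥ v) +
          ω ^ 2 / 2 * (numDof bc T p : ℝ) ^ 6 * (v ⬝ᵥ massMatrix bc T p *ᵥ v) := by
          refine add_le_add h2 (mul_le_mul_of_nonneg_right ?_ h1)
          exact le_mul_of_one_le_right hω2 hN1
      _ = (C₂ + ω ^ 2 / 2) * (numDof bc T p : ℝ) ^ 6 * (v ⬝ᵥ massMatrix bc T p *ᵥ v) := by ring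
      _ ≤ _ := by
          gcongr
          linarith

/-- Definiteness is inherited from the mass matrix, which the energy matrix dominates up to a
constant. -/
theorem energyMatrix_posDef (hab : a < b) (bc : BoundaryCondition) (ω : ℝ) (T : Subdivision a b)
    (p : ℕ) {C : ℝ} (hC : 0 < C)
    (h : ∀ v, v ⬝ᵥ massMatrix bc T p *ᵥ v ≤ C * (v ⬝ᵥ energyMatrix bc ω T p *ᵥ v)) :
    (energyMatrix bc ω T p).PosDef := by
  refine Matrix.PosDef.of_dotProduct_mulVec_pos (energyMatrix_isHermitian bc ω T p)
    fun v hv => ?_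
  have h1 := (massMatrix_posDef hab bc T p).dotProduct_mulVec_pos hv
  rw [star_trivial] at h1 ⊢
  exact pos_of_mul_pos_right (h1.trans_le (h v)) hC.le

end Assembly

/-! ### From a polynomial bound on `γ` to the iteration count. -/

/-- The iteration count is `O(log N log ε⁻¹)` when `γ` is bounded by a power of `N`. -/
theorem exists_ceil_le_log_mul_log {B : ℝ} (hB : 0 < B) (k : ℕ) {ε₀ : ℝ} (hε₀ : ε₀ < 1) :
    ∃ K : ℝ, 0 < K ∧ ∀ (N : ℕ) (ε γ : ℝ), 2 ≤ N → 0 < ε → ε ≤ ε₀ → 0 < γ →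
      γ ≤ B * (N : ℝ) ^ k →
      (⌈Real.log (16 * γ) * Real.log (4 / ε) / Real.pi ^ 2⌉₊ : ℝ) ≤
        K * Real.log N * Real.log ε⁻¹ := by
  rcases le_or_gt ε₀ 0 with h0 | h0
  · exact ⟨1, one_pos, fun N ε γ _ hε hε' => absurd (hε.trans_le hε') (not_lt.mpr h0)⟩
  set ℓ := Real.log ε₀⁻¹ with hℓ
  have hℓ0 : 0 < ℓ := Real.log_pos ((one_lt_inv₀ h0).mpr hε₀)
  have h2 : 0 < Real.log 2 := Real.log_pos (by norm_num)
  have h4 : 0 < Real.log 4 := Real.log_pos (by norm_num)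
  set K₁ := |Real.log (16 * B)| / Real.log 2 + k with hK₁
  set K₂ := Real.log 4 / ℓ + 1 with hK₂
  have hK₁0 : 0 ≤ K₁ := by positivity
  have hK₂0 : 0 < K₂ := by positivity
  -- The second summand pays for the ceiling: `log N · log ε⁻¹ ≥ log 2 · ℓ`, so the extra `1` is
  -- absorbed.
  refine ⟨K₁ * K₂ / Real.pi ^ 2 + 1 / (Real.log 2 * ℓ), by positivity, ?_⟩
  intro N ε γ hN hε hε' hγ hγB
  have hN2 : (2 : ℝ) ≤ N := by exact_mod_cast hN
  have hlogN : Real.log 2 ≤ Real.log N := Real.log_le_log (by norm_num) hN2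
  have hlogε : ℓ ≤ Real.log ε⁻¹ :=
    Real.log_le_log (by positivity) (inv_anti₀ hε hε')
  have hγlog : Real.log (16 * γ) ≤ K₁ * Real.log N := by
    have hN0 : (0 : ℝ) < N := by linarith
    calc Real.log (16 * γ) ≤ Real.log (16 * B * (N : ℝ) ^ k) :=
          Real.log_le_log (by positivity) (by linarith)
      _ = Real.log (16 * B) + k * Real.log N := by
          rw [Real.log_mul (by positivity) (by positivity), Real.log_pow]
      _ ≤ |Real.log (16 * B)| / Real.log 2 * Real.log N + k * Real.log N := by
          refine add_le_add ((le_abs_self _).trans ?_) le_rfl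
          rw [div_mul_eq_mul_div, le_div_iff₀ h2]
          gcongr
      _ = K₁ * Real.log N := by rw [hK₁]; ring
  have hεlog : Real.log (4 / ε) ≤ K₂ * Real.log ε⁻¹ := by
    rw [div_eq_mul_inv, Real.log_mul (by norm_num) (by positivity), hK₂, add_mul, one_mul]
    gcongr
    rw [div_mul_eq_mul_div, le_div_iff₀ hℓ0]
    gcongr
  have hεlog0 : 0 ≤ Real.log (4 / ε) :=
    Real.log_nonneg ((one_le_div hε).mpr (by linarith))
  have hL1 : 0 < Real.log N := h2.trans_le hlogN
  have hL2 : 0 < Real.log ε⁻¹ := hℓ0.trans_le hlogε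
  have hX : Real.log (16 * γ) * Real.log (4 / ε) / Real.pi ^ 2 ≤
      K₁ * K₂ / Real.pi ^ 2 * (Real.log N * Real.log ε⁻¹) := by
    calc _ ≤ K₁ * Real.log N * (K₂ * Real.log ε⁻¹) / Real.pi ^ 2 := by gcongr
      _ = _ := by ring
  have hone : 1 ≤ 1 / (Real.log 2 * ℓ) * (Real.log N * Real.log ε⁻¹) := by
    rw [div_mul_eq_mul_div, one_mul, one_le_div (by positivity)]
    gcongr
  have hceil := (Nat.cast_le (α := ℝ).mpr (Nat.ceil_mono hX)).trans
    (Nat.ceil_lt_add_one (by positivity)).le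
  calc _ ≤ _ := hceil
    _ ≤ K₁ * K₂ / Real.pi ^ 2 * (Real.log N * Real.log ε⁻¹) +
        1 / (Real.log 2 * ℓ) * (Real.log N * Real.log ε⁻¹) := by gcongr
    _ = _ := by ring

end ScreenedPoisson

theorem mainTheorem5 (a b c d : ℝ) (hab : a < b) (hcd : c < d)
    (bc : ScreenedPoisson.BoundaryCondition) (ω : ℝ)
    (hω : bc = ScreenedPoisson.BoundaryCondition.neumann → ω ≠ 0)
    (𝒯x : Set (ScreenedPoisson.Subdivision a b)) (h𝒯x : ScreenedPoisson.QuasiUniform 𝒯x)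
    (𝒯y : Set (ScreenedPoisson.Subdivision c d)) (h𝒯y : ScreenedPoisson.QuasiUniform 𝒯y)
    (ε₀ : ℝ) (hε₀ : ε₀ < 1) :
    ∃ K : ℝ, 0 < K ∧
      ∀ Tx ∈ 𝒯x, ∀ Ty ∈ 𝒯y, ∀ p : ℕ, 1 ≤ p →
        1 ≤ ScreenedPoisson.numDof bc Tx p → 1 ≤ ScreenedPoisson.numDof bc Ty p →
        ∀ N : ℕ, N = max (ScreenedPoisson.numDof bc Tx p) (ScreenedPoisson.numDof bc Ty p) →
        2 ≤ N → ∀ ε : ℝ, 0 < ε → ε ≤ ε₀ →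
        ∃ J : ℕ,
          ScreenedPoisson.IsADIIterationCount
            (ScreenedPoisson.massMatrix bc Tx p) (-ScreenedPoisson.massMatrix bc Ty p)
            (ScreenedPoisson.energyMatrix bc ω Ty p) (ScreenedPoisson.energyMatrix bc ω Tx p)
            ε J ∧
          ScreenedPoisson.IsADIIterationCount
            (ScreenedPoisson.energyMatrix bc ω Tx p) (-ScreenedPoisson.energyMatrix bc ω Ty p)
            (ScreenedPoisson.massMatrix bc Ty p) (ScreenedPoisson.massMatrix bc Tx p)
            ε J ∧
          (J : ℝ) ≤ K * Real.log N * Real.log ε⁻¹ := by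
  obtain ⟨C₁, hC₁, hx⟩ := h𝒯x.exists_spectral_bounds hab bc ω hω
  obtain ⟨C₂, hC₂, hy⟩ := h𝒯y.exists_spectral_bounds hcd bc ω hω
  obtain ⟨K, hK, hceil⟩ := ScreenedPoisson.exists_ceil_le_log_mul_log
    (B := C₁ * C₁) (by positivity) 6 hε₀
  refine ⟨K, hK, ?_⟩
  intro Tx hTx Ty hTy p hp hNx hNy N hN hN2 ε hε hε'
  obtain ⟨hx1, hx2⟩ := hx Tx hTx p hp hNx
  obtain ⟨hy1, -⟩ := hy Ty hTy p hp hNy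
  have : Nonempty (ScreenedPoisson.Dof bc Tx.n p) := Fintype.card_pos_iff.mp hNx
  have : Nonempty (ScreenedPoisson.Dof bc Ty.n p) := Fintype.card_pos_iff.mp hNy
  have hNx0 : (0 : ℝ) < ScreenedPoisson.numDof bc Tx p := by exact_mod_cast hNx
  -- The lower spectral bound is `α = (C₁ Nx⁶)⁻¹` and the upper one `β = C₁`, with `Nx` the
  -- dimension in `x`; so `β/α = C₁² Nx⁶`, and `Nx ≤ N`.
  have hα : 0 < (C₁ * (ScreenedPoisson.numDof bc Tx p : ℝ) ^ 6)⁻¹ := by positivity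
  obtain ⟨γ, hγ0, hγ, h1, h2⟩ := ScreenedPoisson.exists_isADIIterationCount
    (ScreenedPoisson.massMatrix_posDef hab bc Tx p)
    (ScreenedPoisson.energyMatrix_posDef hab bc ω Tx p hC₁ hx1)
    (ScreenedPoisson.massMatrix_posDef hcd bc Ty p)
    (ScreenedPoisson.energyMatrix_posDef hcd bc ω Ty p hC₂ hy1) hα
    (fun v => by
      rw [inv_mul_le_iff₀ (by positivity)]
      exact hx2 v) hx1 ε
  refine ⟨_, h1, h2, hceil N ε γ hN2 hε hε' hγ0 (hγ.trans ?_)⟩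
  rw [div_inv_eq_mul, ← mul_assoc]
  gcongr
  rw [hN]
  exact le_max_left _ _
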